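/- **Setting.** Requests $1,\dots,n$ ($n\ge 1$) lie at nodes of a metric space (the weighted metric graph); request $p$ has a time window $[a_p,b_p)$. A service run at speed $s$ is a sequence of distinct requests with service times, each in the window of its request, such that consecutive services at $u$ (time $t$) and $v$ (time $t'\ge t$) satisfy $d(u,v)\le s(t'-t)$; it may start at any request at any time. Its profit is the number of requests serviced. A run is a $\beta$-approximation at speedup $s$ if it is a service run at speed $s$ and $\beta$ times its profit is at least the profit of every service run at unit speed. **Periods and trimming.** The periods of length $\alpha$ with starting point $o$ are $[o+j\alpha,o+(j+1)\alpha)$, $j\in\mathbb Z$. A window is in $W_\ell$ for these periods if it contains exactly $\ell$ of them and partially overlaps exactly two more. Trimming replaces a window by one of the periods it fully contains, or makes it vanish. Let $\gamma\ge1$ and $\Gamma(n)\ge n$ be such that on the given metric there is a $\gamma$-approximation algorithm REPAIRMAN, with running time at most $\Gamma(n)$, for the repairman problem on trimmed windows (every window a period or vanished, any period length and any speed $s>0$, solution and optimum at the same speed). Let $m$ be the number of distinct sets of periods of length $1/2$, where two starting points in $[0,1/2)$ are identified if all window end points lie in equally numbered periods. **Algorithm SPEEDUPW12.** SPEEDUP,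 for a period length $\alpha$, a starting point $o$ and a trimming rule, considers the $r$ starting points $o+i\alpha/r$, $0\le i<r$ (all real starting points, if no $r$ is given), but only one starting point from each group of starting points that position all window end points equally relative to the periods. For each it trims the windows, calls REPAIRMAN at speed $s$, and retains the best run. SPEEDUPW12 retains the best run over the following calls of SPEEDUP. Phase 1: $\alpha=\frac12$, $o=\frac i4$ $(i=0,1)$, trimming windows in $W_1$ to their first, in $W_2$ to their $j$-th $(j=1,2)$, in $W_3$ to their $k$-th $(k=1,2,3)$ fully contained period. Phase 2: $\alpha=\frac34$, $o=\frac i4$ $(i=0,1,2)$, trimming windows in $W_1$ to their first and in $W_2$ to their $j$-th $(j=1,2)$ one. Phase 3: $\alpha=1$, $o=\frac i4$ $(i=0,1,2,3)$, trimming windows in $W_1$ to their first one. All other windows vanish. (For trimming, a period that begins exactly at the opening time of a window counts as partially overlapped.) **Theorem.** There is an absolute constant $C$ such that, for all metric spaces, $\gamma$, $\Gamma$, REPAIRMAN and requests as above: 1. Let $s=q/r$ with integers $q,r\ge1$ and $1\le s\le2$, and let $o\in\{0,\frac14\}$. If every window is in $W_3$ for each of the $r$ sets of periods of length $\frac12$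 with starting points $o+\frac i{2r}$, $0\le i<r$, then SPEEDUPW12 (with this $r$) finds a $\frac{10\gamma}{s+1}$-approximation at speedup $s$ in at most $C\min\{r,m\}\,\Gamma(n)$ steps. 2. Let $s$ be any real number with $1\le s\le2$. If every window is in $W_3$ for each set of periods of length $\frac12$ for which no window opens on a period boundary, then SPEEDUPW12 (considering all starting points) finds a $\frac{10\gamma}{s+1}$-approximation at speedup $s$ in at most $C\,m\,\Gamma(n)$ steps. -/

import Mathlib

universe u

namespace Repairman

/-! ### Step counting

A computation is a value together with the number of elementary steps spent on it
(unit cost real arithmetic, rounding down, comparisons and list operations). -/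

structure Timed (β : Type u) where
  val : β
  steps : ℕ

instance : Monad Timed where
  pure b := ⟨b, 0⟩
  bind x f := ⟨(f x.val).val, x.steps + (f x.val).steps⟩

/-- Spend `k` elementary steps. -/
def ticks (k : ℕ) : Timed Unit := ⟨(), k⟩

/-! ### The repairman problem -/

/-- `n` service requests at nodes of `V`; request `i` has time window
`[opens i, closes i)`. -/
structure Requests (V : Type u) (n : ℕ) where
  node : Fin n → V
  opens : Fin n → ℝ
  closes : Fin n → ℝ

/-- The time window of a request. -/
def Requests.window {V : Type u} {n : ℕ} (I : Requests V n) (i : Fin n) : Set ℝ :=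
  Set.Ico (I.opens i) (I.closes i)

/-- A run, recorded as the chronological list of the serviced requests with their times of
service. Its profit is the length of the list. -/
abbrev Run (n : ℕ) := List (Fin n × ℝ)

/-- `R` is a service run at speed `s` for the windows `W`: no request is serviced twice, every
service happens within the window of the request, and there is enough time to travel between
consecutive services. The run may start at any request at any time. -/
def IsServiceRun {V : Type u} [PseudoMetricSpace V] {n : ℕ} (node : Fin n → V)
    (W : Fin n → Set ℝ) (s : ℝ) (R : Run n) : Prop :=
  (R.map Prod.fst).Nodup ∧ (∀ x ∈ R, x.2 ∈ W x.1) ∧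
    R.IsChain fun x y => x.2 ≤ y.2 ∧ dist (node x.1) (node y.1) ≤ s * (y.2 - x.2)

/-- `R` is a service run at speed `s` whose profit is at least `1 / β` times the profit of every
service run at unit speed. -/
def IsSpeedupApprox {V : Type u} [PseudoMetricSpace V] {n : ℕ} (I : Requests V n)
    (s β : ℝ) (R : Run n) : Prop :=
  IsServiceRun I.node I.window s R ∧
    ∀ R' : Run n, IsServiceRun I.node I.window 1 R' → (R'.length : ℝ) ≤ β * R.length

/-! ### Periods -/

/-- Period number `j` of the set of periods of length `α` with starting point `o`. -/
def period (α o : ℝ) (j : ℤ) : Set ℝ := Set.Ico (o + j * α) (o + (j + 1) * α)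

/-- The window `[a, b)` is in the set `W_ℓ` for the periods of length `α` with starting point `o`:
it contains exactly `ℓ` periods and partially overlaps exactly two more. -/
def InW (l : ℕ) (α o a b : ℝ) : Prop :=
  {j : ℤ | period α o j ⊆ Set.Ico a b}.encard = l ∧
    {j : ℤ | ¬ period α o j ⊆ Set.Ico a b ∧ (period α o j ∩ Set.Ico a b).Nonempty}.encard = 2

/-- The number of the last period boundary that is not after time `x`. -/
noncomputable def cut (α o x : ℝ) : ℤ := ⌊(x - o) / α⌋

/-- The number `m` of distinct sets of periods of length `1/2`, where two starting points are
identified if they give rise to the same position of all the windows relative to the periods. -/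
noncomputable def numPeriodSets {V : Type u} {n : ℕ} (I : Requests V n) : ℕ :=
  {f : Fin n → ℤ × ℤ | ∃ o ∈ Set.Ico (0 : ℝ) (1 / 2),
    f = fun i => (cut (1 / 2) o (I.opens i), cut (1 / 2) o (I.closes i))}.ncard

/-! ### Requests with trimmed windows -/

/-- Trimmed windows: request `i` is trimmed to period number `slot i`, or vanishes. -/
def slotWindow {n : ℕ} (α o : ℝ) (slot : Fin n → Option ℤ) (i : Fin n) : Set ℝ :=
  match slot i with
  | none => ∅
  | some j => period α o j

/-- An algorithm for the repairman problem on trimmed windows. Its arguments are the number of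
requests, their nodes, their periods, the period length, the starting point of the periods, and
the speed. -/
abbrev TrimmedSolver (V : Type u) :=
  (n : ℕ) → (Fin n → V) → (Fin n → Option ℤ) → ℝ → ℝ → ℝ → Timed (Run n)

/-- `solve` is a `γ`-approximation algorithm for the repairman problem on trimmed windows (all
runs at the same speed), with running time at most `Γ n` for `n` requests. -/
def IsTrimmedApprox {V : Type u} [PseudoMetricSpace V] (γ : ℝ) (Γ : ℕ → ℝ)
    (solve : TrimmedSolver V) : Prop :=
  ∀ (n : ℕ) (node : Fin n → V) (slot : Fin n → Option ℤ) (α o s : ℝ), 0 < α → 0 < s →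
    IsServiceRun node (slotWindow α o slot) s (solve n node slot α o s).val ∧
    (∀ R : Run n, IsServiceRun node (slotWindow α o slot) s R →
      (R.length : ℝ) ≤ γ * (solve n node slot α o s).val.length) ∧
    ((solve n node slot α o s).steps : ℝ) ≤ Γ n

/-! ### The algorithm -/

/-- Trim the window `[a, b)`. The periods fully inside it, not counting one that begins at `a`
itself, are the periods `cut α o a + 1, …, cut α o b - 1`. If there are `l ≥ 1` of them, the
window is trimmed to the one whose position is entry `l` of the list `pick` (positions and entries
are counted from 1); if there are none or the list is too short, the window vanishes. -/
noncomputable def trim (pick : List ℤ) (α o a b : ℝ) : Option ℤ :=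
  if 2 ≤ cut α o b - cut α o a then
    (pick[(cut α o b - cut α o a - 2).toNat]?).map fun k => cut α o a + k
  else none

/-- The latest starting point in `[o, o + α)`, up to multiples of `α`, that has a period boundary
at or just before `x`: for `some r` among the `r` starting points `o + i * (α / r)`, for `none`
among all real starting points. Between two neighbouring values of this function, over the end
points `x` of the windows, all starting points yield the same trimming. -/
noncomputable def snap (g : Option ℕ) (α o x : ℝ) : ℝ :=
  match g with
  | some r => o + ((⌊(x - o) / (α / r)⌋ % (r : ℤ) : ℤ) : ℝ) * (α / r)
  | none => o + Int.fract ((x - o) / α) * α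

open Classical in
/-- Add `x` to a list unless it is there already. -/
noncomputable def insertNew (x : ℝ) : List ℝ → Timed (List ℝ)
  | [] => do
    ticks 1
    pure [x]
  | y :: L => do
    ticks 1
    if y = x then pure (y :: L)
    else do
      let L' ← insertNew x L
      pure (y :: L')

/-- The different sets of periods that have to be considered, given by their starting points. -/
noncomputable def periodStarts {V : Type u} {n : ℕ} (I : Requests V n) (g : Option ℕ)
    (α o : ℝ) : Timed (List ℝ) := do
  ticks (2 * n)
  ((List.finRange n).flatMap fun i =>
    [snap g α o (I.opens i), snap g α o (I.closes i)]).foldlM (fun L x => insertNew x L) []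

/-- Retain the better one of two runs. -/
def better {n : ℕ} (R R' : Run n) : Timed (Run n) := do
  ticks (R.length + R'.length + 1)
  pure (if R.length < R'.length then R' else R)

/-- SPEEDUP for periods of length `α`, starting point `o` and the trimming rule `pick`: for each
different set of periods, trim the windows, solve the trimmed problem at speed `s`, and retain the
best run. The parameter `g` is `some r` if a period is divided into `r` parts (that is, `r` sets of
periods are considered), and `none` if all sets of periods are considered. -/
noncomputable def speedup {V : Type u} (solve : TrimmedSolver V) {n : ℕ} (I : Requests V n)
    (s : ℝ) (g : Option ℕ) (α o : ℝ) (pick : List ℤ) : Timed (Run n) := do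
  let starts ← periodStarts I g α o
  starts.foldlM (fun best o' => do
    ticks n
    let R ← solve n I.node (fun i => trim pick α o' (I.opens i) (I.closes i)) α o' s
    better best R) []

/-- Period length, starting point and trimming rule in the calls of SPEEDUP: phase 1 has periods
of length `1/2` and treats windows in `W_1`, `W_2`, `W_3`, phase 2 has periods of length `3/4` and
treats windows in `W_1`, `W_2`, phase 3 has periods of length `1` and treats windows in `W_1`. -/
noncomputable def schedule : List (ℝ × ℝ × List ℤ) :=
  ([0, 1].flatMap fun i : ℝ => [1, 2].flatMap fun j => [1, 2, 3].map fun k =>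
    (1 / 2, i / 4, [1, j, k])) ++
  ([0, 1, 2].flatMap fun i : ℝ => [1, 2].map fun j => (3 / 4, i / 4, [1, j])) ++
  ([0, 1, 2, 3].map fun i : ℝ => (1, i / 4, [1]))

/-- SPEEDUPW12: run SPEEDUP according to the schedule and retain the best result. -/
noncomputable def speedupW12 {V : Type u} (solve : TrimmedSolver V) {n : ℕ} (I : Requests V n)
    (s : ℝ) (g : Option ℕ) : Timed (Run n) :=
  schedule.foldlM (fun best c => do
    let R ← speedup solve I s g c.1 c.2.1 c.2.2
    better best R) []

end Repairman

namespace Repairman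

/-! ### Folds in the step-counting monad -/

/-! Phase 3 alone carries the approximation bound. Under either hypothesis each window meets exactly
three periods of length 1 that matter: the middle one, to which it is trimmed, and its two
neighbours. Split a unit-speed run by which of these periods contains the service. Translating the
parts in time by 1, 0 and -1 gives three runs for the trimmed windows, feasible at any speed `s ≥
1`. Hence the optimum is at most `3γ` times the profit of REPAIRMAN (`length_le_three_mul_trimmed`),
and `3 ≤ 10 / (s + 1)` because `s ≤ 2`. A single starting point suffices; the other calls can only
improve the result.

The hypotheses reach periods of length 1 through `cut_sub_cut_of_inW`, which turns `InW` into a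
difference of floors. In the rational case, the length-1 starting points are among the given ones
modulo 1/2 (`cut_snap_some_sub`). In the real case, all windows have length exactly 2
(`eq_add_two_of_inW`).

For the running time, each call of SPEEDUP considers at most `r` starting points, and also at most
`6m` (`card_snap_le_numPeriodSets`). -/

theorem foldlM_steps_le {τ : Type u} {σ : Type*} (f : τ → σ → Timed τ) (P : τ → Prop) (K : ℝ)
    (l : List σ) (init : τ) (h0 : P init)
    (h : ∀ b, P b → ∀ c ∈ l, P (f b c).val ∧ ((f b c).steps : ℝ) ≤ K) :
    P (l.foldlM f init).val ∧ ((l.foldlM f init).steps : ℝ) ≤ l.length * K := by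
  induction l generalizing init with
  | nil => exact ⟨h0, by simp [pure]⟩
  | cons c l ih =>
    obtain ⟨h1, h2⟩ := h init h0 c (by simp)
    obtain ⟨h3, h4⟩ := ih (f init c).val h1 fun b hb c' hc' => h b hb c' (by simp [hc'])
    refine ⟨h3, ?_⟩
    have : (((c :: l).foldlM f init).steps : ℝ)
        = (f init c).steps + (l.foldlM f (f init c).val).steps := by
      rw [List.foldlM_cons]
      exact Nat.cast_add _ _
    rw [this]
    push_cast [List.length_cons]
    linarith

theorem foldlM_invariant {τ : Type u} {σ : Type*} (f : τ → σ → Timed τ) (P : τ → Prop)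
    (l : List σ) (init : τ) (h0 : P init) (h : ∀ b, P b → ∀ c ∈ l, P (f b c).val) :
    P (l.foldlM f init).val := by
  induction l generalizing init with
  | nil => exact h0
  | cons c l ih =>
    exact ih (f init c).val (h init h0 c (by simp)) fun b hb c' hc' => h b hb c' (by simp [hc'])

/-- Used with `Q` saying "at least as long as the candidate of `c`": processing `c` establishes it
from any state, and later comparisons keep it. -/
theorem foldlM_reach {τ : Type u} {σ : Type*} (f : τ → σ → Timed τ) (Q : τ → Prop)
    (l : List σ) (init : τ) {c : σ} (hc : c ∈ l) (hQ : ∀ b, Q (f b c).val)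
    (h : ∀ b, Q b → ∀ c' ∈ l, Q (f b c').val) : Q (l.foldlM f init).val := by
  induction l generalizing init with
  | nil => simp at hc
  | cons d l ih =>
    by_cases hcd : c = d
    · subst hcd
      exact foldlM_invariant f Q l _ (hQ init) fun b hb c' hc' => h b hb c' (by simp [hc'])
    · exact ih (f init d).val (by simpa [hcd] using hc) fun b hb c' hc' => h b hb c' (by simp [hc'])

/-! ### Service runs -/

section ServiceRun

variable {V : Type u} [PseudoMetricSpace V] {n : ℕ} {node : Fin n → V} {W W' : Fin n → Set ℝ}
  {s : ℝ} {R : Run n}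

theorem isServiceRun_nil : IsServiceRun node W s [] := by
  simp [IsServiceRun]

theorem IsServiceRun.mono (hR : IsServiceRun node W s R) (h : ∀ i, W i ⊆ W' i) :
    IsServiceRun node W' s R :=
  ⟨hR.1, fun x hx => h _ (hR.2.1 x hx), hR.2.2⟩

theorem IsServiceRun.length_le (hR : IsServiceRun node W s R) : R.length ≤ n := by
  have := hR.1.length_le_card
  simpa using this

/-- The triangle inequality makes the travel condition transitive, so it survives the deletion of
services in between. -/
theorem IsServiceRun.pairwise (hR : IsServiceRun node W s R) :
    R.Pairwise fun x y => x.2 ≤ y.2 ∧ dist (node x.1) (node y.1) ≤ s * (y.2 - x.2) := by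
  have : IsTrans (Fin n × ℝ)
      (fun x y => x.2 ≤ y.2 ∧ dist (node x.1) (node y.1) ≤ s * (y.2 - x.2)) :=
    ⟨fun x y z hxy hyz => ⟨hxy.1.trans hyz.1, by
      have := dist_triangle (node x.1) (node y.1) (node z.1)
      linarith [hxy.2, hyz.2]⟩⟩
  exact List.isChain_iff_pairwise.1 hR.2.2

/-- Servicing only some of the requests, all of them later by the same amount of time. -/
theorem IsServiceRun.filter_shift (hR : IsServiceRun node W 1 R) (hs : 1 ≤ s)
    (p : Fin n × ℝ → Bool) (c : ℝ) (h : ∀ x ∈ R, p x → x.2 + c ∈ W' x.1) :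
    IsServiceRun node W' s ((R.filter p).map fun x => (x.1, x.2 + c)) := by
  refine ⟨?_, ?_, ?_⟩
  · rw [List.map_map]
    exact hR.1.sublist (List.filter_sublist.map _)
  · intro x hx
    obtain ⟨y, hy, rfl⟩ := List.mem_map.1 hx
    obtain ⟨hy, hp⟩ := List.mem_filter.1 hy
    exact h y hy hp
  · refine List.Pairwise.isChain ?_
    rw [List.pairwise_map]
    refine (hR.pairwise.sublist List.filter_sublist).imp ?_
    rintro x y ⟨h1, h2⟩
    refine ⟨by simpa using h1, h2.trans ?_⟩
    nlinarith

end ServiceRun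

theorem length_le_countP_add {σ : Type*} (l : List σ) (p q r : σ → Bool)
    (h : ∀ x ∈ l, p x ∨ q x ∨ r x) :
    l.length ≤ l.countP p + l.countP q + l.countP r := by
  induction l with
  | nil => simp
  | cons x l ih =>
    have h1 := ih fun y hy => h y (by simp [hy])
    have h2 := h x (by simp)
    simp only [List.countP_cons, List.length_cons]
    rcases h2 with h2 | h2 | h2 <;> simp [h2] <;> omega

/-! ### Periods and trimming -/

theorem mem_period_iff {α o x : ℝ} (hα : 0 < α) {j : ℤ} : x ∈ period α o j ↔ cut α o x = j := by
  rw [period, cut, Int.floor_eq_iff, le_div_iff₀ hα, div_lt_iff₀ hα, Set.mem_Ico]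
  constructor <;> rintro ⟨h1, h2⟩ <;> constructor <;> linarith

/-- A list is a legitimate trimming rule if it selects one of the available periods. -/
def ValidPick (pick : List ℤ) : Prop :=
  ∀ (i : ℕ) (k : ℤ), pick[i]? = some k → 1 ≤ k ∧ k ≤ i + 1

/-- Entry `i` of `pick` is read when the cuts of the two end points differ by `i + 2`, so `1 ≤ k ≤ i
+ 1` puts the chosen period strictly between the two cuts. -/
theorem slotWindow_trim_subset {V : Type u} {n : ℕ} (I : Requests V n) {pick : List ℤ}
    (hp : ValidPick pick) {α : ℝ} (hα : 0 < α) (o : ℝ) (i : Fin n) :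
    slotWindow α o (fun i => trim pick α o (I.opens i) (I.closes i)) i ⊆ I.window i := by
  intro x hx
  simp only [slotWindow, trim] at hx
  split at hx
  · exact hx.elim
  rename_i j hj
  split_ifs at hj with h
  obtain ⟨k, hk, rfl⟩ := Option.map_eq_some_iff.1 hj
  obtain ⟨h1, h2⟩ := hp _ _ hk
  have h3 : k ≤ cut α o (I.closes i) - cut α o (I.opens i) - 1 := by omega
  rw [mem_period_iff hα] at hx
  constructor
  · by_contra hlt
    have : cut α o x ≤ cut α o (I.opens i) := by
      unfold cut
      gcongr
      linarith
    omega
  · by_contra hlt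
    have : cut α o (I.closes i) ≤ cut α o x := by
      unfold cut
      gcongr
      linarith
    omega

theorem trim_one {α o a b : ℝ} (h : cut α o b - cut α o a = 2) :
    trim [1] α o a b = some (cut α o a + 1) := by
  simp [trim, h]

/-- With `A = (a - o) / α` and `B = (b - o) / α`, the full periods number `⌊B⌋ - ⌈A⌉` (truncated at
0), while all periods met lie among `⌈B⌉ - ⌊A⌋` many. Having two more than `l` forces both ceilings
to exceed the floors, so neither end point is on a boundary. -/
theorem cut_sub_cut_of_inW {l : ℕ} {α o a b : ℝ} (hα : 0 < α) (h : InW l α o a b) :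
    cut α o b - cut α o a = l + 1 := by
  obtain ⟨h1, h2⟩ := h
  have hlt (j : ℤ) : o + j * α < o + (j + 1) * α := by nlinarith
  have hfull : {j : ℤ | period α o j ⊆ Set.Ico a b}
      = (Finset.Icc ⌈(a - o) / α⌉ (⌊(b - o) / α⌋ - 1) : Finset ℤ) := by
    ext j
    simp only [period, Set.mem_ofPred_eq, Finset.coe_Icc, Set.mem_Icc,
      Set.Ico_subset_Ico_iff (hlt j), Int.ceil_le, Int.le_sub_one_iff, ← Int.add_one_le_iff,
      Int.le_floor, div_le_iff₀ hα, le_div_iff₀ hα]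
    push_cast
    constructor <;> rintro ⟨h1, h2⟩ <;> constructor <;> linarith
  have hmeet : {j : ℤ | (period α o j ∩ Set.Ico a b).Nonempty} ⊆
      (Finset.Icc ⌊(a - o) / α⌋ (⌈(b - o) / α⌉ - 1) : Finset ℤ) := by
    rintro j ⟨x, hx, hx'⟩
    simp only [Finset.coe_Icc, Set.mem_Icc, Int.le_sub_one_iff, Int.lt_ceil, lt_div_iff₀ hα]
    simp only [period, Set.mem_Ico] at hx hx'
    constructor
    · rw [← Int.lt_add_one_iff, Int.floor_lt, div_lt_iff₀ hα]
      push_cast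
      linarith
    · linarith
  have hdisj : Disjoint {j : ℤ | period α o j ⊆ Set.Ico a b}
      {j : ℤ | ¬ period α o j ⊆ Set.Ico a b ∧ (period α o j ∩ Set.Ico a b).Nonempty} := by
    rw [Set.disjoint_left]
    exact fun j hj hj' => hj'.1 hj
  have hunion : ({j : ℤ | period α o j ⊆ Set.Ico a b} ∪
      {j : ℤ | ¬ period α o j ⊆ Set.Ico a b ∧ (period α o j ∩ Set.Ico a b).Nonempty}) ⊆
      (Finset.Icc ⌊(a - o) / α⌋ (⌈(b - o) / α⌉ - 1) : Finset ℤ) := by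
    refine Set.union_subset (fun j hj => hmeet ?_) fun j hj => hmeet hj.2
    exact ⟨o + j * α, ⟨le_rfl, hlt j⟩, hj ⟨le_rfl, hlt j⟩⟩
  have h3 := Set.encard_le_encard hunion
  rw [Set.encard_union_eq hdisj, h1, h2, Set.encard_coe_eq_coe_finsetCard, Int.card_Icc] at h3
  rw [hfull, Set.encard_coe_eq_coe_finsetCard, Int.card_Icc] at h1
  have h3 : l + 2 ≤ (⌈(b - o) / α⌉ - 1 + 1 - ⌊(a - o) / α⌋).toNat := by exact_mod_cast h3
  have h1 : (⌊(b - o) / α⌋ - 1 + 1 - ⌈(a - o) / α⌉).toNat = l := by exact_mod_cast h1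
  have h4 := Int.ceil_le_floor_add_one ((b - o) / α)
  have h5 := Int.ceil_le_floor_add_one ((a - o) / α)
  have h6 := Int.floor_le_ceil ((a - o) / α)
  have h7 := Int.floor_le_ceil ((b - o) / α)
  unfold cut
  omega

theorem cut_half (o x : ℝ) : cut 1 o x = cut (1 / 2) o x / 2 := by
  have h : (x - o) / 1 = (x - o) / (1 / 2) / (2 : ℕ) := by push_cast; ring
  rw [cut, cut, h, Int.floor_div_natCast]
  norm_num

theorem cut_sub_half (o x : ℝ) : cut (1 / 2) (o - 1 / 2) x = cut (1 / 2) o x + 1 := by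
  have h : (x - (o - 1 / 2)) / (1 / 2) = (x - o) / (1 / 2) + 1 := by ring
  rw [cut, cut, h, Int.floor_add_one]

/-- Since 4 is even, halving the cut numbers gives difference 2 whatever their parity. -/
theorem cut_one_sub_of_cut_half_sub {o a b : ℝ}
    (h : cut (1 / 2) o b - cut (1 / 2) o a = 4) : cut 1 o b - cut 1 o a = 2 := by
  rw [cut_half, cut_half]
  omega

/-! ### Shifting a run of unit speed into trimmed windows -/

theorem length_le_three_mul_trimmed {V : Type u} [PseudoMetricSpace V] {γ : ℝ} {Γ : ℕ → ℝ}
    {solve : TrimmedSolver V} (hsolve : IsTrimmedApprox γ Γ solve) {n : ℕ} (I : Requests V n)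
    {s o : ℝ} (hs : 1 ≤ s) (hI : ∀ p, cut 1 o (I.closes p) - cut 1 o (I.opens p) = 2)
    {R : Run n} (hR : IsServiceRun I.node I.window 1 R) :
    (R.length : ℝ) ≤ 3 * γ *
      (solve n I.node (fun i => trim [1] 1 o (I.opens i) (I.closes i)) 1 o s).val.length := by
  have hslot := (hsolve n I.node (fun i => trim [1] 1 o (I.opens i) (I.closes i)) 1 o s
    one_pos (by linarith)).2.1
  -- The services lying `k` periods after the trimmed window of their request; translation by `-k`
  -- moves them into it.
  set p : ℤ → Fin n × ℝ → Bool := fun k x => decide (cut 1 o x.2 = cut 1 o (I.opens x.1) + 1 + k)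
  have hk (k : ℤ) : (R.countP (p k) : ℝ) ≤ γ *
      (solve n I.node (fun i => trim [1] 1 o (I.opens i) (I.closes i)) 1 o s).val.length := by
    have hrun := hR.filter_shift (s := s)
      (W' := slotWindow 1 o (fun i => trim [1] 1 o (I.opens i) (I.closes i))) hs (p k) (-k) ?_
    · simpa [List.countP_eq_length_filter] using hslot _ hrun
    · intro x _ hpx
      simp only [slotWindow, trim_one (hI x.1)]
      rw [mem_period_iff one_pos]
      have hpx : cut 1 o x.2 = cut 1 o (I.opens x.1) + 1 + k := by simpa [p] using hpx
      have : (x.2 + -(k : ℝ) - o) / 1 = (x.2 - o) / 1 - k := by ring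
      rw [cut, this, Int.floor_sub_intCast]
      unfold cut at hpx
      simp only [cut]
      omega
  have hsum := length_le_countP_add R (p (-1)) (p 0) (p 1) (by
    intro x hx
    have hw := hR.2.1 x hx
    have h1 : cut 1 o (I.opens x.1) ≤ cut 1 o x.2 := by
      unfold cut
      gcongr
      exact hw.1
    have h2 : cut 1 o x.2 ≤ cut 1 o (I.closes x.1) := by
      unfold cut
      gcongr
      exact hw.2.le
    have h3 := hI x.1
    simp only [p, decide_eq_true_eq]
    omega)
  have hsum : (R.length : ℝ) ≤ R.countP (p (-1)) + R.countP (p 0) + R.countP (p 1) := by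
    exact_mod_cast hsum
  linarith [hk (-1), hk 0, hk 1]

/-! ### The starting points considered -/

theorem insertNew_nil (x : ℝ) : (insertNew x []).val = [x] ∧ (insertNew x []).steps = 1 := by
  rw [insertNew]
  exact ⟨rfl, rfl⟩

theorem insertNew_cons (x y : ℝ) (L : List ℝ) :
    (insertNew x (y :: L)).val = (if y = x then y :: L else y :: (insertNew x L).val) ∧
    (insertNew x (y :: L)).steps = 1 + (if y = x then 0 else (insertNew x L).steps) := by
  rw [insertNew]
  split_ifs <;> exact ⟨rfl, rfl⟩

theorem mem_insertNew {x z : ℝ} {L : List ℝ} :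
    z ∈ (insertNew x L).val ↔ z = x ∨ z ∈ L := by
  induction L with
  | nil => simp [insertNew_nil]
  | cons y L ih =>
    rw [(insertNew_cons x y L).1]
    split_ifs with h
    · simp [h]
    · simp only [List.mem_cons, ih]
      tauto

theorem nodup_insertNew {x : ℝ} {L : List ℝ} (hL : L.Nodup) : (insertNew x L).val.Nodup := by
  induction L with
  | nil => simp [insertNew_nil]
  | cons y L ih =>
    rw [(insertNew_cons x y L).1]
    rw [List.nodup_cons] at hL
    split_ifs with h
    · exact List.nodup_cons.2 hL
    · exact List.nodup_cons.2 ⟨by rw [mem_insertNew]; tauto, ih hL.2⟩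

theorem steps_insertNew_le (x : ℝ) (L : List ℝ) : (insertNew x L).steps ≤ L.length + 1 := by
  induction L with
  | nil => simp [insertNew_nil]
  | cons y L ih =>
    rw [(insertNew_cons x y L).2, List.length_cons]
    split_ifs <;> omega

/-- The opening and closing times of all windows. -/
def Requests.endPoints {V : Type u} {n : ℕ} (I : Requests V n) : List ℝ :=
  (List.finRange n).flatMap fun i => [I.opens i, I.closes i]

theorem Requests.length_endPoints {V : Type u} {n : ℕ} (I : Requests V n) :
    I.endPoints.length = 2 * n := by
  simp [Requests.endPoints, List.length_flatMap, mul_comm]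

theorem Requests.mem_endPoints {V : Type u} {n : ℕ} (I : Requests V n) {x : ℝ} :
    x ∈ I.endPoints ↔ ∃ i, x = I.opens i ∨ x = I.closes i := by
  simp [Requests.endPoints]

theorem periodStarts_eq {V : Type u} {n : ℕ} (I : Requests V n) (g : Option ℕ) (α o : ℝ) :
    (periodStarts I g α o).val =
      ((I.endPoints.map (snap g α o)).foldlM (fun L x => insertNew x L) []).val ∧
    (periodStarts I g α o).steps =
      2 * n + ((I.endPoints.map (snap g α o)).foldlM (fun L x => insertNew x L) []).steps := by
  have h : I.endPoints.map (snap g α o) = (List.finRange n).flatMap fun i =>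
      [snap g α o (I.opens i), snap g α o (I.closes i)] := by
    simp [Requests.endPoints, List.map_flatMap]
  rw [h]
  exact ⟨rfl, rfl⟩

/-- Each of the `2n` insertions scans a duplicate-free list of at most `D` values. -/
theorem periodStarts_spec {V : Type u} {n : ℕ} (I : Requests V n) (g : Option ℕ) (α o : ℝ)
    {D : ℕ} (hD : (I.endPoints.map (snap g α o)).toFinset.card ≤ D) :
    (∀ x ∈ (periodStarts I g α o).val, ∃ y, x = snap g α o y) ∧
    (periodStarts I g α o).val.length ≤ D ∧
    ((periodStarts I g α o).steps : ℝ) ≤ 2 * n + 2 * n * (D + 1) := by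
  set l := I.endPoints.map (snap g α o) with hl
  have hlen {L : List ℝ} (h : L.Nodup ∧ ∀ x ∈ L, x ∈ l) : L.length ≤ D := by
    rw [← List.toFinset_card_of_nodup h.1]
    exact (Finset.card_le_card fun x hx => by simpa using h.2 x (by simpa using hx)).trans hD
  obtain ⟨h1, h2⟩ := foldlM_steps_le (fun L x => insertNew x L)
    (fun L => L.Nodup ∧ ∀ x ∈ L, x ∈ l) (D + 1) l [] (by simp) (by
      intro L hL x hx
      refine ⟨⟨nodup_insertNew hL.1, fun z hz => ?_⟩, ?_⟩
      · rcases mem_insertNew.1 hz with rfl | hz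
        exacts [hx, hL.2 z hz]
      · have h1 := steps_insertNew_le x L
        have h2 := hlen hL
        exact_mod_cast h1.trans (by omega))
  obtain ⟨e1, e2⟩ := periodStarts_eq I g α o
  rw [← hl] at e1 e2
  rw [e1, e2]
  refine ⟨fun x hx => ?_, hlen h1, ?_⟩
  · obtain ⟨y, -, rfl⟩ := List.mem_map.1 (h1.2 x hx)
    exact ⟨y, rfl⟩
  · have : (l.length : ℝ) = 2 * n := by
      rw [hl, List.length_map, I.length_endPoints]
      push_cast
      ring
    rw [this] at h2
    push_cast
    linarith

theorem exists_mem_periodStarts {V : Type u} {n : ℕ} (hn : 0 < n) (I : Requests V n)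
    (g : Option ℕ) (α o : ℝ) : ∃ x, x ∈ (periodStarts I g α o).val := by
  rw [(periodStarts_eq I g α o).1]
  have hmem : snap g α o (I.opens ⟨0, hn⟩) ∈ I.endPoints.map (snap g α o) :=
    List.mem_map_of_mem (I.mem_endPoints.2 ⟨_, Or.inl rfl⟩)
  exact ⟨_, foldlM_reach _ (fun L => snap g α o (I.opens ⟨0, hn⟩) ∈ L) _ _ hmem
    (fun L => mem_insertNew.2 (Or.inl rfl)) fun L hL c _ => mem_insertNew.2 (Or.inr hL)⟩

theorem snap_add_mul {g : Option ℕ} (hg : g ≠ some 0) {α : ℝ} (hα : 0 < α) (o x : ℝ) (z : ℤ) :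
    snap g α o (x + z * α) = snap g α o x := by
  cases g with
  | none =>
    have : (x + z * α - o) / α = (x - o) / α + z := by field_simp; ring
    simp only [snap]
    rw [this, Int.fract_add_intCast]
  | some r =>
    have hr : (r : ℝ) ≠ 0 := by
      rintro h
      exact hg (by simpa using h)
    have : (x + z * α - o) / (α / r) = (x - o) / (α / r) + ((z * r : ℤ) : ℝ) := by
      push_cast
      field_simp
      ring
    simp only [snap]
    rw [this, Int.floor_add_intCast, Int.add_mul_emod_self_right]

theorem card_snap_le_some {V : Type u} {n : ℕ} (I : Requests V n) {r : ℕ} (hr : 0 < r) (α o : ℝ) :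
    (I.endPoints.map (snap (some r) α o)).toFinset.card ≤ r := by
  have : (I.endPoints.map (snap (some r) α o)).toFinset ⊆
      (Finset.range r).image fun k : ℕ => o + (k : ℝ) * (α / r) := by
    intro y hy
    obtain ⟨x, -, rfl⟩ := List.mem_map.1 (List.mem_toFinset.1 hy)
    have hr' : (0 : ℤ) < r := by exact_mod_cast hr
    have h1 := Int.emod_nonneg ⌊(x - o) / (α / r)⌋ hr'.ne'
    have h2 := Int.emod_lt_of_pos ⌊(x - o) / (α / r)⌋ hr'
    refine Finset.mem_image.2 ⟨(⌊(x - o) / (α / r)⌋ % (r : ℤ)).toNat,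
      Finset.mem_range.2 (by omega), ?_⟩
    simp only [snap]
    congr 2
    exact_mod_cast congrArg (Int.cast (R := ℝ)) (Int.toNat_of_nonneg h1)
  simpa using (Finset.card_le_card this).trans Finset.card_image_le

/-- Different positions of window end points within their periods of length `1/2` are separated
by sets of periods. -/
theorem card_fract_le_numPeriodSets {V : Type u} {n : ℕ} (I : Requests V n) :
    (I.endPoints.map fun x => Int.fract (2 * x)).toFinset.card ≤ numPeriodSets I := by
  have hcut (o x : ℝ) : cut (1 / 2) o x = ⌊2 * x - 2 * o⌋ := by
    rw [cut]
    congr 1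
    ring
  rw [numPeriodSets, ← Set.ncard_coe_finset]
  refine Set.ncard_le_ncard_of_injOn
    (fun f i => (cut (1 / 2) (f / 2) (I.opens i), cut (1 / 2) (f / 2) (I.closes i))) ?_ ?_ ?_
  · intro f hf
    obtain ⟨x, -, rfl⟩ := List.mem_map.1 (List.mem_toFinset.1 (Finset.mem_coe.1 hf))
    have h1 := Int.fract_nonneg (2 * x)
    have h2 := Int.fract_lt_one (2 * x)
    exact ⟨Int.fract (2 * x) / 2, ⟨by linarith, by linarith⟩, rfl⟩
  -- The starting point `Int.fract (2 * x) / 2` puts a boundary exactly at `x`; the later one moves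
  -- this boundary past `x`, so the cut of `x` drops.
  · have key : ∀ x ∈ I.endPoints, ∀ f', Int.fract (2 * x) < f' → f' < 1 →
        (fun i => (cut (1 / 2) (Int.fract (2 * x) / 2) (I.opens i),
          cut (1 / 2) (Int.fract (2 * x) / 2) (I.closes i))) ≠
        (fun i => (cut (1 / 2) (f' / 2) (I.opens i), cut (1 / 2) (f' / 2) (I.closes i))) := by
      intro x hx f' h1 h2 heq
      have hne : cut (1 / 2) (Int.fract (2 * x) / 2) x ≠ cut (1 / 2) (f' / 2) x := by
        have e1 : 2 * x - 2 * (Int.fract (2 * x) / 2) = (⌊2 * x⌋ : ℤ) := by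
          have := Int.self_sub_fract (2 * x)
          linarith
        have e2 : 2 * x - 2 * (f' / 2) < (⌊2 * x⌋ : ℤ) := by
          have := Int.self_sub_fract (2 * x)
          linarith
        rw [hcut, hcut, e1, Int.floor_intCast]
        exact (Int.floor_lt.2 e2).ne'
      obtain ⟨i, rfl | rfl⟩ := I.mem_endPoints.1 hx
      · exact hne (congrArg Prod.fst (congrFun heq i))
      · exact hne (congrArg Prod.snd (congrFun heq i))
    intro f hf f' hf' heq
    obtain ⟨x, hx, rfl⟩ := List.mem_map.1 (List.mem_toFinset.1 (Finset.mem_coe.1 hf))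
    obtain ⟨x', hx', rfl⟩ := List.mem_map.1 (List.mem_toFinset.1 (Finset.mem_coe.1 hf'))
    rcases lt_trichotomy (Int.fract (2 * x)) (Int.fract (2 * x')) with h | h | h
    · exact (key x hx _ h (Int.fract_lt_one _) heq).elim
    · exact h
    · exact (key x' hx' _ h (Int.fract_lt_one _) heq.symm).elim
  -- Finiteness is essential, as `Set.ncard` of an infinite set is 0.
  · have hfin : (Set.univ.pi fun i : Fin n =>
        (Set.Icc (⌊2 * I.opens i⌋ - 1) ⌊2 * I.opens i⌋) ×ˢ
          (Set.Icc (⌊2 * I.closes i⌋ - 1) ⌊2 * I.closes i⌋)).Finite :=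
      Set.Finite.pi fun i => (Set.finite_Icc _ _).prod (Set.finite_Icc _ _)
    refine hfin.subset ?_
    rintro _ ⟨o, ho, rfl⟩ i -
    have hmem (x : ℝ) : cut (1 / 2) o x ∈ Set.Icc (⌊2 * x⌋ - 1) ⌊2 * x⌋ := by
      rw [hcut]
      constructor
      · rw [Int.le_floor]
        push_cast
        linarith [Int.floor_le (2 * x), ho.2]
      · gcongr
        linarith [ho.1]
    exact ⟨hmem _, hmem _⟩

/-- The lengths 1/2, 3/4 and 1 all divide 3, so `snap` depends only on `x` modulo 3, that is, on `⌊2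
* x⌋` modulo 6 and `Int.fract (2 * x)`. The latter takes at most `m` values. -/
theorem card_snap_le_numPeriodSets {V : Type u} {n : ℕ} (I : Requests V n) {g : Option ℕ}
    (hg : g ≠ some 0) {α : ℝ} (hα : 0 < α) {z : ℤ} (hz : z * α = 3) (o : ℝ) :
    (I.endPoints.map (snap g α o)).toFinset.card ≤ 6 * numPeriodSets I := by
  have : (I.endPoints.map (snap g α o)).toFinset ⊆
      ((Finset.range 6) ×ˢ (I.endPoints.map fun x => Int.fract (2 * x)).toFinset).image
        fun jf => snap g α o (jf.1 / 2 + jf.2 / 2) := by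
    intro y hy
    obtain ⟨x, hx, rfl⟩ := List.mem_map.1 (List.mem_toFinset.1 hy)
    have h1 := Int.emod_nonneg ⌊2 * x⌋ (b := 6) (by norm_num)
    have h2 := Int.emod_lt_of_pos ⌊2 * x⌋ (b := 6) (by norm_num)
    refine Finset.mem_image.2 ⟨((⌊2 * x⌋ % 6).toNat, Int.fract (2 * x)),
      Finset.mem_product.2 ⟨Finset.mem_range.2 (by simp only; omega),
        List.mem_toFinset.2 (List.mem_map_of_mem hx)⟩, ?_⟩
    have h3 : (((⌊2 * x⌋ % 6).toNat : ℕ) : ℝ) = ((⌊2 * x⌋ % 6 : ℤ) : ℝ) := by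
      exact_mod_cast congrArg (Int.cast (R := ℝ)) (Int.toNat_of_nonneg h1)
    have h4 : ((⌊2 * x⌋ % 6 : ℤ) : ℝ) + 6 * ((⌊2 * x⌋ / 6 : ℤ) : ℝ) = ⌊2 * x⌋ := by
      exact_mod_cast Int.emod_add_mul_ediv ⌊2 * x⌋ 6
    have h5 := Int.self_sub_fract (2 * x)
    rw [← snap_add_mul hg hα o _ (⌊2 * x⌋ / 6 * z)]
    congr 1
    simp only
    rw [h3]
    push_cast
    rw [mul_assoc, hz]
    linarith
  calc _ ≤ _ := Finset.card_le_card this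
    _ ≤ _ := Finset.card_image_le
    _ ≤ _ := by
      rw [Finset.card_product, Finset.card_range]
      exact Nat.mul_le_mul_left 6 (card_fract_le_numPeriodSets I)

/-! ### The algorithm -/

theorem better_val {n : ℕ} (R R' : Run n) :
    (better R R').val = if R.length < R'.length then R' else R := rfl

theorem better_steps {n : ℕ} (R R' : Run n) :
    (better R R').steps = R.length + R'.length + 1 := rfl

theorem length_le_better_left {n : ℕ} (R R' : Run n) : R.length ≤ (better R R').val.length := by
  rw [better_val]
  split_ifs <;> omega

theorem length_le_better_right {n : ℕ} (R R' : Run n) : R'.length ≤ (better R R').val.length := by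
  rw [better_val]
  split_ifs <;> omega

section Algorithm

variable {V : Type u} [PseudoMetricSpace V] {γ : ℝ} {Γ : ℕ → ℝ} {solve : TrimmedSolver V}

theorem speedup_spec (hsolve : IsTrimmedApprox γ Γ solve) {n : ℕ} (hn : 0 < n)
    (hΓ : (n : ℝ) ≤ Γ n) (I : Requests V n) {s : ℝ} (hs : 0 < s) (g : Option ℕ) {α : ℝ}
    (hα : 0 < α) (o : ℝ) {pick : List ℤ} (hp : ValidPick pick) {D : ℕ}
    (hD : (I.endPoints.map (snap g α o)).toFinset.card ≤ D) :
    IsServiceRun I.node I.window s (speedup solve I s g α o pick).val ∧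
    (∀ o' ∈ (periodStarts I g α o).val,
      (solve n I.node (fun i => trim pick α o' (I.opens i) (I.closes i)) α o' s).val.length ≤
        (speedup solve I s g α o pick).val.length) ∧
    ((speedup solve I s g α o pick).steps : ℝ) ≤ 11 * (D * Γ n) := by
  obtain ⟨-, hlen, hsteps⟩ := periodStarts_spec I g α o hD
  set G : ℝ → Timed (Run n) := fun o' =>
    solve n I.node (fun i => trim pick α o' (I.opens i) (I.closes i)) α o' s
  have hG (o' : ℝ) := hsolve n I.node (fun i => trim pick α o' (I.opens i) (I.closes i)) α o' s hα hs
  have hGrun (o' : ℝ) : IsServiceRun I.node I.window s (G o').val :=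
    (hG o').1.mono (slotWindow_trim_subset I hp hα o')
  set f : Run n → ℝ → Timed (Run n) := fun best o' => do
    ticks n
    let R ← G o'
    better best R
  have fval (b : Run n) (o' : ℝ) : (f b o').val = (better b (G o').val).val := rfl
  have fsteps (b : Run n) (o' : ℝ) :
      (f b o').steps = n + ((G o').steps + (better b (G o').val).steps) := rfl
  have hval : (speedup solve I s g α o pick).val =
    ((periodStarts I g α o).val.foldlM f []).val := rfl
  have hst : (speedup solve I s g α o pick).steps = (periodStarts I g α o).steps +
    ((periodStarts I g α o).val.foldlM f []).steps := rfl
  -- Per starting point: `n` for trimming, `Γ n` for solving, `2n + 1` for comparing.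
  obtain ⟨h1, h2⟩ := foldlM_steps_le f (IsServiceRun I.node I.window s) (3 * n + 1 + Γ n)
    (periodStarts I g α o).val [] isServiceRun_nil (by
      intro b hb o' _
      constructor
      · rw [fval, better_val]
        split_ifs
        exacts [hGrun o', hb]
      · have e1 : (b.length : ℝ) ≤ n := by exact_mod_cast hb.length_le
        have e2 : ((G o').val.length : ℝ) ≤ n := by exact_mod_cast (hGrun o').length_le
        have e3 : ((G o').steps : ℝ) ≤ Γ n := (hG o').2.2
        rw [fsteps, better_steps]
        push_cast
        linarith)
  rw [hval, hst]
  refine ⟨h1, fun o' ho' => ?_, ?_⟩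
  · exact foldlM_reach f (fun b => (G o').val.length ≤ b.length) _ _ ho'
      (fun b => by rw [fval]; exact length_le_better_right _ _)
      fun b hb c _ => by rw [fval]; exact hb.trans (length_le_better_left _ _)
  · have hn' : (1 : ℝ) ≤ n := by exact_mod_cast hn
    have hD1 : (1 : ℝ) ≤ D := by
      obtain ⟨x, hx⟩ := exists_mem_periodStarts hn I g α o
      exact_mod_cast (List.length_pos_of_mem hx).trans_le hlen
    have hlen' : ((periodStarts I g α o).val.length : ℝ) ≤ D := by exact_mod_cast hlen
    -- The constant 11 is 5 from the loop and 6 from computing the starting points, using `1 ≤ n ≤ Γ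
    -- n` and `1 ≤ D`.
    have a1 : ((periodStarts I g α o).val.length : ℝ) * (3 * n + 1 + Γ n) ≤ D * (5 * Γ n) :=
      mul_le_mul hlen' (by linarith) (by linarith) (by linarith)
    have a2 : (n : ℝ) * D ≤ Γ n * D := by gcongr
    have a3 : (Γ n : ℝ) * 1 ≤ Γ n * D := by
      have : 0 ≤ Γ n := by linarith
      gcongr
    push_cast
    nlinarith

theorem schedule_valid {c : ℝ × ℝ × List ℤ} (hc : c ∈ schedule) :
    0 < c.1 ∧ (∃ z : ℤ, z * c.1 = 3) ∧ ValidPick c.2.2 := by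
  have h1 : ValidPick [1] := by
    rintro (_ | i) k hk <;> simp at hk
    omega
  have h2 {a : ℤ} (ha : 1 ≤ a ∧ a ≤ 2) : ValidPick [1, a] := by
    rintro (_ | _ | i) k hk <;> simp at hk <;> push_cast <;> omega
  have h3 {a b : ℤ} (ha : 1 ≤ a ∧ a ≤ 2) (hb : 1 ≤ b ∧ b ≤ 3) : ValidPick [1, a, b] := by
    rintro (_ | _ | _ | i) k hk <;> simp at hk <;> push_cast <;> omega
  simp only [schedule, List.mem_append, List.mem_flatMap, List.mem_map] at hc
  rcases hc with (⟨i, -, a, ha, b, hb, rfl⟩ | ⟨i, -, a, ha, rfl⟩) | ⟨i, -, rfl⟩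
  · refine ⟨by norm_num, ⟨6, by norm_num⟩, h3 ?_ ?_⟩
    · simp at ha
      omega
    · simp at hb
      omega
  · refine ⟨by norm_num, ⟨4, by norm_num⟩, h2 ?_⟩
    simp at ha
    omega
  · exact ⟨by norm_num, ⟨3, by norm_num⟩, h1⟩

theorem length_schedule : schedule.length = 22 := by
  simp [schedule]

theorem speedupW12_spec (hsolve : IsTrimmedApprox γ Γ solve) {n : ℕ} (hn : 0 < n)
    (hΓ : (n : ℝ) ≤ Γ n) (I : Requests V n) {s : ℝ} (hs : 0 < s) (g : Option ℕ) {D : ℕ}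
    (hD : ∀ c ∈ schedule, (I.endPoints.map (snap g c.1 c.2.1)).toFinset.card ≤ D) :
    IsServiceRun I.node I.window s (speedupW12 solve I s g).val ∧
    (∀ c ∈ schedule, (speedup solve I s g c.1 c.2.1 c.2.2).val.length ≤
      (speedupW12 solve I s g).val.length) ∧
    ((speedupW12 solve I s g).steps : ℝ) ≤ 308 * (D * Γ n) := by
  have hspec (c) (hc : c ∈ schedule) := speedup_spec hsolve hn hΓ I hs g
    (schedule_valid hc).1 c.2.1 (schedule_valid hc).2.2 (hD c hc)
  set G : ℝ × ℝ × List ℤ → Timed (Run n) := fun c => speedup solve I s g c.1 c.2.1 c.2.2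
  set f : Run n → ℝ × ℝ × List ℤ → Timed (Run n) := fun best c => do
    let R ← G c
    better best R
  have fval (b : Run n) (c) : (f b c).val = (better b (G c).val).val := rfl
  have fsteps (b : Run n) (c) :
      (f b c).steps = (G c).steps + (better b (G c).val).steps := rfl
  have hdef : speedupW12 solve I s g = schedule.foldlM f [] := rfl
  have hn' : (1 : ℝ) ≤ n := by exact_mod_cast hn
  have hD1 : (1 : ℝ) ≤ D := by
    obtain ⟨c, hc⟩ := List.exists_mem_of_length_pos (l := schedule) (by simp [length_schedule])
    have hmem : snap g c.1 c.2.1 (I.opens ⟨0, hn⟩) ∈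
        (I.endPoints.map (snap g c.1 c.2.1)).toFinset :=
      List.mem_toFinset.2 (List.mem_map_of_mem (I.mem_endPoints.2 ⟨_, Or.inl rfl⟩))
    exact_mod_cast (Finset.card_pos.2 ⟨_, hmem⟩).trans_le (hD c hc)
  -- 11 for the call and 3 for the comparison; the 22 calls give 308.
  obtain ⟨h1, h2⟩ := foldlM_steps_le f (IsServiceRun I.node I.window s) (14 * (D * Γ n))
    schedule [] isServiceRun_nil (by
      intro b hb c hc
      obtain ⟨r1, -, r3⟩ := hspec c hc
      constructor
      · rw [fval, better_val]
        split_ifs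
        exacts [r1, hb]
      · have e1 : (b.length : ℝ) ≤ n := by exact_mod_cast hb.length_le
        have e2 : ((G c).val.length : ℝ) ≤ n := by exact_mod_cast r1.length_le
        have e3 : ((G c).steps : ℝ) ≤ 11 * (D * Γ n) := r3
        rw [fsteps, better_steps]
        push_cast
        nlinarith)
  rw [hdef]
  refine ⟨h1, fun c hc => ?_, ?_⟩
  · exact foldlM_reach f (fun b => (G c).val.length ≤ b.length) _ _ hc
      (fun b => by rw [fval]; exact length_le_better_right _ _)
      fun b hb c _ => by rw [fval]; exact hb.trans (length_le_better_left _ _)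
  · rw [length_schedule] at h2
    push_cast at h2
    linarith

/-- If the periods of length `1` considered in phase 3 for the starting point `c / 4` cut every
window twice, then the result is a good approximation. -/
theorem isSpeedupApprox_speedupW12 (hsolve : IsTrimmedApprox γ Γ solve) (hγ : 1 ≤ γ) {n : ℕ}
    (hn : 0 < n) (hΓ : (n : ℝ) ≤ Γ n) (I : Requests V n) {s : ℝ} (hs : 1 ≤ s) (hs2 : s ≤ 2)
    (g : Option ℕ) {c : ℝ} (hc : (1, c / 4, [1]) ∈ schedule)
    (hI : ∀ x p, cut 1 (snap g 1 (c / 4) x) (I.closes p) -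
      cut 1 (snap g 1 (c / 4) x) (I.opens p) = 2) :
    IsSpeedupApprox I s (10 * γ / (s + 1)) (speedupW12 solve I s g).val := by
  have hs0 : 0 < s := by linarith
  -- Only the quality matters here, so any bound `D` will do.
  obtain ⟨D, hD⟩ : ∃ D, ∀ c ∈ schedule, (I.endPoints.map (snap g c.1 c.2.1)).toFinset.card ≤ D :=
    ⟨I.endPoints.length, fun c _ => (List.toFinset_card_le _).trans (by simp)⟩
  obtain ⟨h1, h2, -⟩ := speedupW12_spec hsolve hn hΓ I hs0 g hD
  refine ⟨h1, fun R hR => ?_⟩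
  obtain ⟨o, ho⟩ := exists_mem_periodStarts hn I g 1 (c / 4)
  obtain ⟨y, rfl⟩ := (periodStarts_spec I g 1 (c / 4) le_rfl).1 o ho
  have h3 := (speedup_spec hsolve hn hΓ I hs0 g (schedule_valid hc).1 (c / 4)
    (schedule_valid hc).2.2 (hD _ hc)).2.1 _ ho
  have h4 := length_le_three_mul_trimmed hsolve I hs (hI y) hR
  have h5 : ((solve n I.node (fun i => trim [1] 1 (snap g 1 (c / 4) y) (I.opens i) (I.closes i))
      1 (snap g 1 (c / 4) y) s).val.length : ℝ) ≤ (speedupW12 solve I s g).val.length := by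
    exact_mod_cast h3.trans (h2 _ hc)
  have h6 : 3 * γ ≤ 10 * γ / (s + 1) := by
    rw [le_div_iff₀ (by linarith)]
    nlinarith
  calc (R.length : ℝ) ≤ _ := h4
    _ ≤ 3 * γ * (speedupW12 solve I s g).val.length := by gcongr
    _ ≤ _ := by gcongr

end Algorithm

/-! ### The two cases of the theorem -/

/-- The snapped point `o + k / r` is the given starting point with `i = 2k` if `2k < r`. Otherwise
it is the one with `i = 2k - r`, moved by 1/2, a full half-length period. -/
theorem cut_snap_some_sub {r : ℕ} (hr : 0 < r) {o a b : ℝ}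
    (h : ∀ i < r, InW 3 (1 / 2) (o + i / (2 * r)) a b) (x : ℝ) :
    cut 1 (snap (some r) 1 o x) b - cut 1 (snap (some r) 1 o x) a = 2 := by
  have hr' : (0 : ℤ) < r := by exact_mod_cast hr
  have hr0 : (r : ℝ) ≠ 0 := by positivity
  have h1 := Int.emod_nonneg ⌊(x - o) / (1 / r)⌋ hr'.ne'
  have h2 := Int.emod_lt_of_pos ⌊(x - o) / (1 / r)⌋ hr'
  simp only [snap]
  obtain ⟨k, hk⟩ := Int.eq_ofNat_of_zero_le h1
  rw [hk] at h2 ⊢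
  have h2 : k < r := by exact_mod_cast h2
  apply cut_one_sub_of_cut_half_sub
  by_cases hkr : 2 * k < r
  · have h3 := cut_sub_cut_of_inW (by norm_num) (h (2 * k) hkr)
    have e : o + ((2 * k : ℕ) : ℝ) / (2 * r) = o + ((k : ℤ) : ℝ) * (1 / r) := by
      push_cast
      field_simp
    rw [e] at h3
    simpa using h3
  · obtain ⟨i, hi⟩ := Nat.exists_eq_add_of_le (not_lt.1 hkr)
    have h3 := cut_sub_cut_of_inW (by norm_num) (h i (by omega))
    have hi' : (2 * k : ℝ) = r + i := by exact_mod_cast hi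
    have e : o + (i : ℝ) / (2 * r) = o + ((k : ℤ) : ℝ) * (1 / r) - 1 / 2 := by
      push_cast
      field_simp
      linarith
    rw [e, cut_sub_half, cut_sub_half] at h3
    push_cast at h3 ⊢
    linarith

/-- A window that is cut into five parts by all sets of periods of length `1/2`, apart from
countably many, has length `2`. -/
theorem eq_add_two_of_inW {a b : ℝ} {N : Set ℝ} (hN : N.Countable)
    (h : ∀ o, o ∉ N → InW 3 (1 / 2) o a b) : b = a + 2 := by
  have hex {x y : ℝ} (hxy : x < y) : ∃ o ∈ Set.Ioo x y, o ∉ N := by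
    obtain ⟨o, ho, ho'⟩ := (hN.dense_compl ℝ).exists_between hxy
    exact ⟨o, ho', ho⟩
  have hcut {o : ℝ} (ho : o ∉ N) : cut (1 / 2) o b - cut (1 / 2) o a = 4 := by
    simpa using cut_sub_cut_of_inW (by norm_num) (h o ho)
  have hfl (o x : ℝ) : cut (1 / 2) o x = ⌊2 * (x - o)⌋ := by
    rw [cut]
    congr 1
    ring
  rcases lt_trichotomy b (a + 2) with hlt | heq | hgt
  -- Too short a window fits strictly inside four consecutive periods `[o, o + 2)`, so its cuts
  -- differ by at most 3. Too long a window starts before some `o` and ends after `o + 2`, giving at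
  -- least 5.
  · obtain ⟨o, ⟨h1, h2⟩, ho⟩ := hex (show b - 2 < a by linarith)
    have h3 := hcut ho
    have h4 : 0 ≤ ⌊2 * (a - o)⌋ := Int.floor_nonneg.2 (by linarith)
    have h5 : ⌊2 * (b - o)⌋ < 4 := Int.floor_lt.2 (by push_cast; linarith)
    rw [hfl, hfl] at h3
    omega
  · exact heq
  · obtain ⟨o, ⟨h1, h2⟩, ho⟩ := hex (show a < b - 2 by linarith)
    have h3 := hcut ho
    have h4 : ⌊2 * (a - o)⌋ < 0 := Int.floor_lt.2 (by push_cast; linarith)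
    have h5 : 4 ≤ ⌊2 * (b - o)⌋ := Int.le_floor.2 (by push_cast; linarith)
    rw [hfl, hfl] at h3
    omega

theorem cut_one_add_two (o a : ℝ) : cut 1 o (a + 2) - cut 1 o a = 2 := by
  have h : (a + 2 - o) / 1 = (a - o) / 1 + (2 : ℤ) := by push_cast; ring
  rw [cut, cut, h, Int.floor_add_intCast]
  ring

end Repairman

theorem mainTheorem6 :
    ∃ C : ℝ, ∀ (V : Type u) [PseudoMetricSpace V] (γ : ℝ) (Γ : ℕ → ℝ)
      (solve : Repairman.TrimmedSolver V),
      1 ≤ γ → (∀ n : ℕ, (n : ℝ) ≤ Γ n) → Repairman.IsTrimmedApprox γ Γ solve →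
      ∀ (n : ℕ) (I : Repairman.Requests V n), 0 < n →
        -- rational speedup `s = q / r`
        (∀ q r c : ℕ, 0 < r → 1 ≤ (q : ℝ) / r → (q : ℝ) / r ≤ 2 → c ≤ 1 →
          (∀ i < r, ∀ p : Fin n,
            Repairman.InW 3 (1 / 2) ((c : ℝ) / 4 + i / (2 * r)) (I.opens p) (I.closes p)) →
          Repairman.IsSpeedupApprox I ((q : ℝ) / r) (10 * γ / ((q : ℝ) / r + 1))
            (Repairman.speedupW12 solve I ((q : ℝ) / r) (some r)).val ∧
          ((Repairman.speedupW12 solve I ((q : ℝ) / r) (some r)).steps : ℝ) ≤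
            C * (min r (Repairman.numPeriodSets I) * Γ n)) ∧
        -- arbitrary real speedup `s`
        (∀ s : ℝ, 1 ≤ s → s ≤ 2 →
          (∀ o : ℝ, (∀ (p : Fin n) (j : ℤ), I.opens p ≠ o + j / 2) → ∀ p : Fin n,
            Repairman.InW 3 (1 / 2) o (I.opens p) (I.closes p)) →
          Repairman.IsSpeedupApprox I s (10 * γ / (s + 1))
            (Repairman.speedupW12 solve I s none).val ∧
          ((Repairman.speedupW12 solve I s none).steps : ℝ) ≤
            C * (Repairman.numPeriodSets I * Γ n)) := by
  open Repairman in
  -- 1848 is 6 times 308.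
  refine ⟨1848, fun V _ γ Γ solve hγ hΓ hsolve n I hn => ⟨?_, ?_⟩⟩
  · intro q r c hr hs hs2 hc hI
    refine ⟨isSpeedupApprox_speedupW12 hsolve hγ hn (hΓ n) I hs hs2 (some r) (c := c) ?_
      fun x p => cut_snap_some_sub hr (fun i hi => hI i hi p) x, ?_⟩
    · interval_cases c <;> simp [schedule]
    · have hD : ∀ c ∈ schedule,
          (I.endPoints.map (snap (some r) c.1 c.2.1)).toFinset.card ≤
            6 * min r (numPeriodSets I) := by
        intro c hc
        obtain ⟨h1, ⟨z, hz⟩, -⟩ := schedule_valid hc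
        have h2 := card_snap_le_some I hr c.1 c.2.1
        have h3 := card_snap_le_numPeriodSets I (g := some r) (by simpa using hr.ne') h1 hz c.2.1
        omega
      have h := (speedupW12_spec hsolve hn (hΓ n) I (zero_lt_one.trans_le hs) (some r) hD).2.2
      push_cast at h ⊢
      linarith
  · intro s hs hs2 hI
    have hlen (p : Fin n) : I.closes p = I.opens p + 2 := by
      refine eq_add_two_of_inW
        (N := Set.range fun pj : Fin n × ℤ => I.opens pj.1 - pj.2 / 2)
        (Set.countable_range _) fun o ho => hI o (fun p j h => ho ⟨(p, j), ?_⟩) p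
      simp only
      linarith
    refine ⟨isSpeedupApprox_speedupW12 hsolve hγ hn (hΓ n) I hs hs2 none (c := 0) ?_
      fun x p => by rw [hlen p]; exact cut_one_add_two _ _, ?_⟩
    · simp [schedule]
    · have hD : ∀ c ∈ schedule,
          (I.endPoints.map (snap none c.1 c.2.1)).toFinset.card ≤ 6 * numPeriodSets I := by
        intro c hc
        obtain ⟨h1, ⟨z, hz⟩, -⟩ := schedule_valid hc
        exact card_snap_le_numPeriodSets I (by simp) h1 hz c.2.1
      have h := (speedupW12_spec hsolve hn (hΓ n) I (zero_lt_one.trans_le hs) none hD).2.2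
      push_cast at h
      linarith
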